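/- Let $k$ be a field of characteristic $p>0$, let $P$ be a finite poset, and let $J(P)$ be the set of its poset ideals (subsets closed downwards, including $\emptyset$). The Hibi ring is the subalgebra $$R=k\Big[\,T\prod_{x\in I}X_x \;\Big|\; I\in J(P)\Big]\subseteq k[T,X_x \mid x\in P],$$ graded by the degree in $T$, and $\mathfrak m=R_+$ is its graded maximal ideal, generated by the monomials $T\prod_{x\in I}X_x$. For a real number $t\ge 0$, the pair $(R,\mathfrak m^t)$ is called F-pure if for all large $q=p^e$ there is $d\in\mathfrak m^{\lceil t(q-1)\rceil}$ such that the $R$-linear map $R\to R^{1/q}$, $1\mapsto d^{1/q}$, splits; and $\operatorname{fpt}(\mathfrak m)=\sup\{t\ge 0\mid (R,\mathfrak m^t)\text{ is F-pure}\}$. Write $x\lessdot y$ if $y$ covers $x$. A path in a finite poset $Q$ is a sequence $C=(q_1,\dots,q_t)$, $t\ge 1$, of distinct elements such that $q_1$ is minimal, $q_i\lessdot q_{i+1}$ or $q_{i+1}\lessdot q_i$ for all $i<t$, and $q_{t-1}\lessdot q_t$ if $t\ge 2$. It is maximal if $q_t$ is a maximal element of $Q$. Its upper length $\operatorname{len}^*C$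 is the number of $i<t$ with $q_i\lessdot q_{i+1}$. Call $q_i$ locally maximal in $C$ if $i=t$, or if $1<i<t$, $q_{i-1}\lessdot q_i$ and $q_{i+1}\lessdot q_i$; call it locally minimal in $C$ if $i=1$, or if $1<i<t$, $q_i\lessdot q_{i-1}$ and $q_i\lessdot q_{i+1}$. Cut $C$ just after each locally maximal $q_i$ with $i<t$ and just after each locally minimal $q_i$ with $i>1$; this gives a decomposition $C=A_1+D_1+A_2+\dots+D_{n-1}+A_n$ into consecutive blocks, where each $A_i$ is an ascending chain ending with a locally maximal element $t(A_i)$ and each $D_i$ is a descending chain ending with a locally minimal element. For $S\subseteq Q$ let $\langle S\rangle$ be the poset ideal generated by $S$. The path $C$ satisfies condition $(*)$ if for all $1\le i\le n-1$ 1. $D_i\cap\big(\bigcup_{m=1}^{i-1}\langle A_m\rangle\cup\langle A_i\setminus\{t(A_i)\}\rangle\cup\{t(A_i)\}\big)=\emptyset$, and 2. $A_{i+1}\cap\bigcup_{m=1}^{i}\langle A_m\rangle=\emptyset$. The lower rank of $Q$ is $\operatorname{rank}_*Q=\min\{\operatorname{len}^*C\mid C\text{ is a maximal path of }Q\text{ satisfying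 }(*)\}$. Let $\overline P=P\cup\{-\infty,\infty\}$ be $P$ with a new least and a new greatest element adjoined. **Theorem.** We have $\operatorname{fpt}(\mathfrak m)=\operatorname{rank}_*\overline P$, and if $P\neq\emptyset$, then $\operatorname{rank}_*\overline P=\operatorname{rank}_*P+2$. In particular, $\operatorname{fpt}(\mathfrak m)\in\mathbb N$. -/

import Mathlib

open scoped NNReal ENNReal

/-! ### Paths in the Hasse diagram of a poset, condition (*) and the lower rank -/

/-- A path `(q 0, q 1, …, q n)` in the Hasse diagram of `P`: distinct elements, consecutive ones
related by a covering relation, starting at a minimal element, whose last step (if there is one)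
ascends. Only the values `q 0, …, q n` are part of the path; the values of `q` beyond `n` are
irrelevant and never used. -/
structure HassePath (P : Type*) [PartialOrder P] where
  n : ℕ
  q : ℕ → P
  distinct : Set.InjOn q (Set.Iic n)
  isMin_first : IsMin (q 0)
  last_ascends : ∀ i, i + 1 = n → q i ⋖ q (i + 1)
  step : ∀ i < n, q i ⋖ q (i + 1) ∨ q (i + 1) ⋖ q i

namespace HassePath

variable {P : Type*} [PartialOrder P]

/-- A path is maximal if it ends at a maximal element of the poset. -/
def IsMaximalPath (C : HassePath P) : Prop := IsMax (C.q C.n)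

/-- The upper length: the number of ascending edges. -/
noncomputable def upperLength (C : HassePath P) : ℕ :=
  Set.ncard {i : ℕ | i < C.n ∧ C.q i ⋖ C.q (i + 1)}

/-- Position `i` carries a locally maximal element of the path. By convention the last element of
the path is locally maximal (and the first one counts as locally minimal). -/
def IsLocMax (C : HassePath P) (i : ℕ) : Prop :=
  i = C.n ∨ (0 < i ∧ i < C.n ∧ C.q (i - 1) ⋖ C.q i ∧ C.q (i + 1) ⋖ C.q i)

/-- The number of locally maximal positions strictly before position `j`. -/
noncomputable def locMaxBefore (C : HassePath P) (j : ℕ) : ℕ :=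
  Set.ncard {i : ℕ | i < j ∧ C.IsLocMax i}

/-- The number `N` of ascending chains in the decomposition
`C = A₁ + D₁ + A₂ + ⋯ + D_{N-1} + A_N`; each of them ends at a locally maximal element. -/
noncomputable def numAsc (C : HassePath P) : ℕ :=
  Set.ncard {i : ℕ | C.IsLocMax i}

/-- The vertex set `V(A_m)`, `m ≥ 1`, of the `m`-th ascending chain of the decomposition. It
consists of the vertices that are reached by an ascending edge (or are the first vertex) and have
exactly `m - 1` locally maximal elements before them. So `A_m` ends with a locally maximal element
and, for `m ≥ 2`, begins just after a locally minimal one. -/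
def asc (C : HassePath P) (m : ℕ) : Set P :=
  {x | ∃ j ≤ C.n, (j = 0 ∨ C.q (j - 1) ⋖ C.q j) ∧ C.locMaxBefore j + 1 = m ∧ C.q j = x}

/-- The vertex set `V(D_m)`, `m ≥ 1`, of the `m`-th descending chain of the decomposition. It
consists of the vertices that are reached by a descending edge and have exactly `m` locally
maximal elements before them. So `D_m` begins just after the locally maximal element that ends
`A_m` and ends with a locally minimal element. -/
def desc (C : HassePath P) (m : ℕ) : Set P :=
  {x | ∃ j ≤ C.n, 0 < j ∧ C.q j ⋖ C.q (j - 1) ∧ C.locMaxBefore j = m ∧ C.q j = x}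

/-- The singleton `{t(A_m)}`, where `t(A_m)` is the largest element of the chain `A_m`. -/
def ascTop (C : HassePath P) (m : ℕ) : Set P := {x | IsGreatest (C.asc m) x}

/-- Condition (*), where `lowerClosure S` is the poset ideal generated by `S`. -/
def SatisfiesStar (C : HassePath P) : Prop :=
  ∀ i, 1 ≤ i → i < C.numAsc →
    Disjoint (C.desc i)
      ((⋃ m ∈ Set.Ico 1 i, (lowerClosure (C.asc m) : Set P)) ∪
        (lowerClosure (C.asc i \ C.ascTop i) : Set P) ∪ C.ascTop i) ∧
    Disjoint (C.asc (i + 1)) (⋃ m ∈ Set.Icc 1 i, (lowerClosure (C.asc m) : Set P))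

end HassePath

/-- The lower rank: the minimum of the upper lengths of the maximal paths satisfying (*). It is
taken in `ℕ∞`, so that it is finite exactly if there is such a path, and then it is a minimum. -/
noncomputable def lowerRank (P : Type*) [PartialOrder P] : ℕ∞ :=
  sInf {l : ℕ∞ | ∃ C : HassePath P, C.IsMaximalPath ∧ C.SatisfiesStar ∧ l = (C.upperLength : ℕ∞)}

/-- The poset `P` with a new least and a new greatest element adjoined. -/
abbrev ExtendedPoset (P : Type*) : Type _ := WithBot (WithTop P)

/-! ### Hibi rings -/

section Hibi

variable (k : Type*) [Field k] (P : Type*) [PartialOrder P] [Fintype P]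

open Classical in
/-- The monomial `T * ∏_{p ∈ I} X_p` of a poset ideal `I` in the polynomial ring with the
variables `T = X none` and `X_p = X (some p)`. -/
noncomputable def hibiMonomial (I : LowerSet P) : MvPolynomial (Option P) k :=
  MvPolynomial.X none * ∏ p ∈ Finset.univ.filter (fun p : P => p ∈ I), MvPolynomial.X (some p)

/-- The Hibi ring of the distributive lattice `J(P)` of poset ideals of `P` over `k`. -/
noncomputable def hibiRing : Subalgebra k (MvPolynomial (Option P) k) :=
  Algebra.adjoin k (Set.range (hibiMonomial k P))

/-- The generators of the Hibi ring, as elements of it. -/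
noncomputable def hibiGen (I : LowerSet P) : hibiRing k P :=
  ⟨hibiMonomial k P I, Algebra.subset_adjoin ⟨I, rfl⟩⟩

/-- The graded maximal ideal `R₊` of the Hibi ring `R`, which is standard graded by the degree in
`T`: it is generated by the generators of degree one. -/
noncomputable def hibiMaxIdeal : Ideal (hibiRing k P) :=
  Ideal.span (Set.range (hibiGen k P))

instance hibiRing_charP (p : ℕ) [CharP k p] : CharP (hibiRing k P) p :=
  charP_of_injective_algebraMap (algebraMap k (hibiRing k P)).injective p

end Hibi

/-! ### The F-pure threshold -/

/-- The `R`-module `R^{1/q}`, `q = p ^ e`, in the form `Fᵉ_* R`: the elements are those of `R`,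
where `x` stands for `x^{1/q}`, and `r : R` acts by `r • x^{1/q} = (r ^ q * x)^{1/q}`. -/
def FrobeniusRoot (R : Type*) (_p _e : ℕ) : Type _ := R

section FThreshold

variable {R : Type*} [CommRing R] (p : ℕ) [Fact p.Prime] [CharP R p]

instance (e : ℕ) : AddCommGroup (FrobeniusRoot R p e) := inferInstanceAs (AddCommGroup R)

instance (e : ℕ) : Module R (FrobeniusRoot R p e) :=
  Module.compHom R (iterateFrobenius R p e)

/-- The element `d^{1/q}` of `R^{1/q}`, `q = p ^ e`. -/
def frobeniusRoot (e : ℕ) (d : R) : FrobeniusRoot R p e := d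

theorem smul_frobeniusRoot (e : ℕ) (r d : R) :
    r • frobeniusRoot p e d = frobeniusRoot p e (r ^ p ^ e * d) := rfl

/-- The `R`-linear map `R → R^{1/q}`, `1 ↦ d^{1/q}`, splits. -/
def RootMapSplits (e : ℕ) (d : R) : Prop :=
  ∃ f : FrobeniusRoot R p e →ₗ[R] R,
    f ∘ₗ LinearMap.toSpanSingleton R (FrobeniusRoot R p e) (frobeniusRoot p e d) = LinearMap.id

/-- The pair `(R, 𝔞^t)` is F-pure: for all large `q = p ^ e` there is `d ∈ 𝔞^⌈t(q-1)⌉` such that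
the map `R → R^{1/q}`, `1 ↦ d^{1/q}`, splits. -/
def IsFPurePair (a : Ideal R) (t : ℝ≥0) : Prop :=
  ∀ᶠ e : ℕ in Filter.atTop, ∃ d ∈ a ^ ⌈(t : ℝ) * ((p : ℝ) ^ e - 1)⌉₊, RootMapSplits p e d

/-- The F-pure threshold `sup {t ≥ 0 | (R, 𝔞^t) is F-pure}`, as a supremum in `[0, ∞]`. -/
noncomputable def fpt (a : Ideal R) : ℝ≥0∞ :=
  sSup {s : ℝ≥0∞ | ∃ t : ℝ≥0, IsFPurePair p a t ∧ s = (t : ℝ≥0∞)}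

end FThreshold

/-! ### Counting positions -/

/-! Both invariants equal δ(-∞), where δ(x), `topDist`, is the least number of ascents of a walk
from x to ∞ in the Hasse diagram of the extended poset.

For the lower rank: δ is antitone and drops by at most one on a cover, so every maximal path from -∞
has at least δ(-∞) ascents, with or without (*). Conversely, take a walk with the fewest ascents
and, among those, the fewest edges. It repeats no vertex, and δ drops by exactly one on its ascents
and is constant on its descents. Such a path satisfies (*) (`satisfiesStar_of_potential`): a vertex
lying below an earlier one cannot be separated from it by an ascent, since δ would then be smaller
there, yet δ is antitone. Deleting the two ends of this path gives the formula for P.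

For the threshold: the monomials of R are the antitone functions on the extended poset that vanish
at ∞; the value at -∞ is the degree (`mem_hibiRing_iff`). A monomial w gives a split map 1 ↦ w^{1/q}
if and only if w drops by less than q on every cover (`rootMapSplits_of_covBy`,
`coeff_zero_eq_zero_of_covBy`), and any d that gives a split map contains such a monomial. Summing
drops of at most q - 1 along a walk bounds the degree of w by (q - 1)δ(-∞), and w = (q - 1)δ attains
this bound. -/

open Classical in
theorem ncard_lt_and_eq_count (s : ℕ → Prop) (n : ℕ) :
    Set.ncard {i : ℕ | i < n ∧ s i} = Nat.count s n := by
  rw [Nat.count_eq_card_filter_range, ← Set.ncard_coe_finset]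
  congr 1
  ext i
  simp

namespace HassePath

variable {Q : Type*} [PartialOrder Q] (C : HassePath Q)

theorem locMaxBefore_zero : C.locMaxBefore 0 = 0 := by
  simp [locMaxBefore]

theorem locMaxBefore_succ_of_isLocMax {j : ℕ} (h : C.IsLocMax j) :
    C.locMaxBefore (j + 1) = C.locMaxBefore j + 1 := by
  classical
  simp only [locMaxBefore, ncard_lt_and_eq_count, Nat.count_succ, if_pos h]

theorem locMaxBefore_succ_of_not_isLocMax {j : ℕ} (h : ¬ C.IsLocMax j) :
    C.locMaxBefore (j + 1) = C.locMaxBefore j := by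
  classical
  simp only [locMaxBefore, ncard_lt_and_eq_count, Nat.count_succ, if_neg h, add_zero]

theorem locMaxBefore_mono : Monotone C.locMaxBefore := by
  classical
  intro a b h
  simp only [locMaxBefore, ncard_lt_and_eq_count]
  exact Nat.count_monotone _ h

theorem lt_of_locMaxBefore_lt {a b : ℕ} (h : C.locMaxBefore a < C.locMaxBefore b) : a < b :=
  C.locMaxBefore_mono.reflect_lt h

/-- Two locally maximal positions are separated by an ascending edge. -/
theorem exists_ascending_of_locMaxBefore_lt {a b : ℕ} (hb : b ≤ C.n)
    (h : C.locMaxBefore (a + 1) < C.locMaxBefore b) :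
    ∃ i, a ≤ i ∧ i < b ∧ C.q i ⋖ C.q (i + 1) := by
  induction b with
  | zero => simp [locMaxBefore_zero] at h
  | succ b ih =>
    have hab := C.lt_of_locMaxBefore_lt h
    by_cases hm : C.IsLocMax b
    · rcases hm with hm | ⟨h0, -, h1, -⟩
      · omega
      · refine ⟨b - 1, by omega, by omega, ?_⟩
        rwa [Nat.sub_add_cancel h0]
    · rw [C.locMaxBefore_succ_of_not_isLocMax hm] at h
      obtain ⟨i, h1, h2, h3⟩ := ih (by omega) h
      exact ⟨i, h1, by omega, h3⟩

/-- An ascending chain of the decomposition stays below the next locally maximal element. -/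
theorem le_of_locMaxBefore_eq {a b : ℕ} (hab : a ≤ b) (hb : b ≤ C.n)
    (ha : a = 0 ∨ C.q (a - 1) ⋖ C.q a) (h : C.locMaxBefore a = C.locMaxBefore b) :
    C.q a ≤ C.q b ∧ (b = 0 ∨ C.q (b - 1) ⋖ C.q b) := by
  induction b, hab using Nat.le_induction with
  | base => exact ⟨le_rfl, ha⟩
  | succ b hab ih =>
    have h1 : C.locMaxBefore a = C.locMaxBefore b :=
      le_antisymm (C.locMaxBefore_mono hab) (h ▸ C.locMaxBefore_mono b.le_succ)
    have hm : ¬ C.IsLocMax b := fun hm ↦ by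
      have := C.locMaxBefore_succ_of_isLocMax hm
      omega
    obtain ⟨hle, hasc⟩ := ih (by omega) h1
    -- No descent leaves the first vertex, which is minimal, and a descent right after an ascent
    -- would make position `b` locally maximal.
    have hup : C.q b ⋖ C.q (b + 1) := by
      refine (C.step b (by omega)).resolve_right fun hd ↦ ?_
      rcases hasc with rfl | hasc
      · exact hd.lt.not_ge (C.isMin_first hd.le)
      · rcases Nat.eq_zero_or_pos b with rfl | h0
        · exact hd.lt.not_ge (C.isMin_first hd.le)
        · exact hm (Or.inr ⟨h0, by omega, hasc, hd⟩)
    exact ⟨hle.trans hup.le, Or.inr (by simpa using hup)⟩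

section Potential

variable {C} {d : Q → ℕ}

/-- A path along which an antitone function drops by exactly one on ascending edges and is
constant on descending ones satisfies (*). -/
theorem satisfiesStar_of_potential (hd : Antitone d)
    (hup : ∀ i < C.n, C.q i ⋖ C.q (i + 1) → d (C.q i) = d (C.q (i + 1)) + 1)
    (hdown : ∀ i < C.n, C.q (i + 1) ⋖ C.q i → d (C.q i) = d (C.q (i + 1))) :
    C.SatisfiesStar := by
  have hmono : ∀ {a b : ℕ}, a ≤ b → b ≤ C.n → d (C.q b) ≤ d (C.q a) := by
    intro a b hab
    induction b, hab using Nat.le_induction with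
    | base => exact fun _ ↦ le_rfl
    | succ b hab ih =>
      intro hb
      have := ih (by omega)
      rcases C.step b (by omega) with h | h
      · have := hup b (by omega) h
        omega
      · have := hdown b (by omega) h
        omega
  -- An ascent between the positions makes `d` strictly smaller at the later one, whereas
  -- antitonicity makes it at least as large there. Each clause of (*), apart from the one on
  -- t(A_i), reduces to finding such an ascent.
  have key : ∀ {a b : ℕ}, b ≤ C.n → C.q b ≤ C.q a →
      ¬ ∃ i, a ≤ i ∧ i < b ∧ C.q i ⋖ C.q (i + 1) := by
    rintro a b hb hle ⟨i, h1, h2, h3⟩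
    have h4 := hup i (by omega) h3
    have h5 := hmono h1 (by omega)
    have h6 := hmono (show i + 1 ≤ b by omega) hb
    have h7 := hd hle
    omega
  intro i hi _
  constructor
  · rw [Set.disjoint_left]
    rintro _ ⟨j, hj, -, -, hji, rfl⟩ ((hx | hx) | hx)
    · simp only [Set.mem_iUnion, Set.mem_Ico] at hx
      obtain ⟨m, ⟨-, hm⟩, hx⟩ := hx
      obtain ⟨_, ⟨a, -, -, ham, rfl⟩, hle⟩ := hx
      have h1 : C.locMaxBefore (a + 1) ≤ C.locMaxBefore a + 1 := by
        by_cases h : C.IsLocMax a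
        · exact (C.locMaxBefore_succ_of_isLocMax h).le
        · exact (C.locMaxBefore_succ_of_not_isLocMax h).le.trans (Nat.le_succ _)
      exact key hj hle (C.exists_ascending_of_locMaxBefore_lt hj (by omega))
    · obtain ⟨_, ⟨⟨a, han, haasc, ham, rfl⟩, hnot⟩, hle⟩ := hx
      -- If position `a` of A_i were not locally maximal, the end of A_i would come later and be
      -- reached by an ascent. So `a` is the end of A_i, whose vertex has been removed.
      have hlm : C.IsLocMax a := by
        by_contra hlm
        refine key hj hle (C.exists_ascending_of_locMaxBefore_lt hj ?_)
        rw [C.locMaxBefore_succ_of_not_isLocMax hlm]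
        omega
      refine hnot ⟨⟨a, han, haasc, ham, rfl⟩, ?_⟩
      rintro _ ⟨b, -, hbasc, hbm, rfl⟩
      have hba : b ≤ a := by
        by_contra hab
        have h1 := C.locMaxBefore_mono (show a + 1 ≤ b by omega)
        rw [C.locMaxBefore_succ_of_isLocMax hlm] at h1
        omega
      exact (C.le_of_locMaxBefore_eq hba han hbasc (by omega)).1
    · obtain ⟨⟨a, han, -, ham, hax⟩, -⟩ := hx
      have := C.distinct han hj hax
      subst this
      omega
  · rw [Set.disjoint_left]
    rintro _ ⟨j, hj, hasc, hji, rfl⟩ hx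
    simp only [Set.mem_iUnion, Set.mem_Icc] at hx
    obtain ⟨m, ⟨-, hm⟩, hx⟩ := hx
    obtain ⟨_, ⟨a, -, -, ham, rfl⟩, hle⟩ := hx
    have haj : a < j := C.lt_of_locMaxBefore_lt (by omega)
    rcases hasc with rfl | hasc
    · omega
    · refine key hj hle ⟨j - 1, by omega, by omega, ?_⟩
      rwa [Nat.sub_add_cancel (by omega)]

/-- Only ascents can lower `d`, each by at most one; the bound telescopes and needs no (*). -/
theorem le_add_upperLength (hup : ∀ x y, x ⋖ y → d x ≤ d y + 1)
    (hdown : ∀ x y, x ⋖ y → d y ≤ d x) :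
    d (C.q 0) ≤ d (C.q C.n) + C.upperLength := by
  classical
  rw [upperLength, ncard_lt_and_eq_count]
  suffices ∀ j ≤ C.n, d (C.q 0) ≤ d (C.q j) + Nat.count (fun i ↦ C.q i ⋖ C.q (i + 1)) j from
    this _ le_rfl
  intro j
  induction j with
  | zero => simp
  | succ j ih =>
    intro hj
    have h1 := ih (by omega)
    rw [Nat.count_succ]
    rcases C.step j (by omega) with h | h
    · have := hup _ _ h
      rw [if_pos h]
      omega
    · have := hdown _ _ h
      omega

theorem eq_add_upperLength
    (hup : ∀ i < C.n, C.q i ⋖ C.q (i + 1) → d (C.q i) = d (C.q (i + 1)) + 1)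
    (hdown : ∀ i < C.n, C.q (i + 1) ⋖ C.q i → d (C.q i) = d (C.q (i + 1))) :
    d (C.q 0) = d (C.q C.n) + C.upperLength := by
  classical
  rw [upperLength, ncard_lt_and_eq_count]
  suffices ∀ j ≤ C.n, d (C.q 0) = d (C.q j) + Nat.count (fun i ↦ C.q i ⋖ C.q (i + 1)) j from
    this _ le_rfl
  intro j
  induction j with
  | zero => simp
  | succ j ih =>
    intro hj
    have h1 := ih (by omega)
    rw [Nat.count_succ]
    rcases C.step j (by omega) with h | h
    · have := hup j (by omega) h
      rw [if_pos h]
      omega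
    · have := hdown j (by omega) h
      rw [if_neg (fun h' ↦ h.lt.not_gt h'.lt)]
      omega

end Potential

end HassePath

/-! ### The distance to the top in the Hasse diagram -/

/-- `HasseWalk x c l`: there is a walk in the Hasse diagram from `x` to the greatest element with
`l` edges, of which `c` ascend. -/
inductive HasseWalk {α : Type*} [PartialOrder α] [OrderTop α] : α → ℕ → ℕ → Prop
  | top : HasseWalk ⊤ 0 0
  | up {x y : α} {c l : ℕ} : x ⋖ y → HasseWalk y c l → HasseWalk x (c + 1) (l + 1)
  | down {x y : α} {c l : ℕ} : y ⋖ x → HasseWalk y c l → HasseWalk x c (l + 1)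

section TopDist

variable {α : Type*} [PartialOrder α] [OrderTop α]

/-- The least number of ascending edges of a walk from `x` to the greatest element. -/
noncomputable def topDist (x : α) : ℕ := sInf {c | ∃ l, HasseWalk x c l}

/-- The least number of edges of a walk from `x` to the greatest element that has the least number
of ascending edges. -/
noncomputable def topSteps (x : α) : ℕ := sInf {l | HasseWalk x (topDist x) l}

theorem HasseWalk.topDist_le {x : α} {c l : ℕ} (h : HasseWalk x c l) : topDist x ≤ c :=
  Nat.sInf_le ⟨l, h⟩

/-- A function with values zero at the top and bounded slope on covers is bounded along walks. -/
theorem HasseWalk.le_mul {x : α} {c l : ℕ} (h : HasseWalk x c l) {v : α → ℕ} {b : ℕ}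
    (htop : v ⊤ = 0) (hv : Antitone v) (hb : ∀ x y, x ⋖ y → v x ≤ v y + b) : v x ≤ c * b := by
  induction h with
  | top => simp [htop]
  | up hxy _ ih =>
    have := hb _ _ hxy
    rw [add_mul, one_mul]
    omega
  | down hxy _ ih => exact (hv hxy.le).trans ih

theorem topDist_top : topDist (⊤ : α) = 0 := Nat.le_zero.1 HasseWalk.top.topDist_le

variable [Finite α]

theorem exists_hasseWalk (x : α) : ∃ c l, HasseWalk x c l := by
  induction x using (wellFounded_gt (α := α)).induction with
  | _ x ih =>
    by_cases hx : IsMax x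
    · rw [isMax_iff_eq_top.1 hx]
      exact ⟨0, 0, .top⟩
    · obtain ⟨y, hy⟩ := exists_covBy_of_wellFoundedLT hx
      obtain ⟨c, l, h⟩ := ih y hy.lt
      exact ⟨_, _, .up hy h⟩

theorem exists_hasseWalk_topDist (x : α) : ∃ l, HasseWalk x (topDist x) l :=
  Nat.sInf_mem (s := {c | ∃ l, HasseWalk x c l}) (exists_hasseWalk x)

theorem hasseWalk_topSteps (x : α) : HasseWalk x (topDist x) (topSteps x) :=
  Nat.sInf_mem (s := {l | HasseWalk x (topDist x) l}) (exists_hasseWalk_topDist x)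

theorem topDist_le_of_covBy {x y : α} (h : x ⋖ y) : topDist x ≤ topDist y + 1 :=
  (HasseWalk.up h (hasseWalk_topSteps y)).topDist_le

/-- Stepping down a cover costs no ascent, and in a finite poset antitonicity can be checked on
covers. -/
theorem topDist_antitone : Antitone (topDist : α → ℕ) := by
  classical
  cases nonempty_fintype α
  let _ : LocallyFiniteOrder α := Fintype.toLocallyFiniteOrder
  exact (antitone_iff_forall_covBy _).2 fun x _ h ↦
    (HasseWalk.down h (hasseWalk_topSteps x)).topDist_le

theorem le_topDist_mul {v : α → ℕ} {b : ℕ} (htop : v ⊤ = 0) (hv : Antitone v)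
    (hb : ∀ x y, x ⋖ y → v x ≤ v y + b) (x : α) : v x ≤ topDist x * b :=
  (hasseWalk_topSteps x).le_mul htop hv hb

/-- Every element that is not the greatest one has a neighbour which is closer to it. -/
theorem exists_next (x : α) (hx : x ≠ ⊤) : ∃ y, topSteps y < topSteps x ∧
    ((x ⋖ y ∧ topDist x = topDist y + 1) ∨ (y ⋖ x ∧ topDist x = topDist y)) := by
  have h := hasseWalk_topSteps x
  generalize hc : topDist x = c at h
  generalize hl : topSteps x = l at h
  cases h with
  | top => exact absurd rfl hx
  | @up _ y c l hxy hw =>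
    have h1 := hw.topDist_le
    have h2 := topDist_le_of_covBy hxy
    -- The rest of an optimal walk is again optimal: it bounds the distance of `y` above, and the
    -- cover bounds it below.
    obtain rfl : topDist y = c := by omega
    exact ⟨y, Nat.lt_succ_of_le (Nat.sInf_le hw), .inl ⟨hxy, rfl⟩⟩
  | @down _ y _ l hxy hw =>
    have h1 := hw.topDist_le
    have h2 := topDist_antitone hxy.le
    obtain rfl : topDist y = c := by omega
    exact ⟨y, Nat.lt_succ_of_le (Nat.sInf_le hw), .inr ⟨hxy, rfl⟩⟩

/-- Iterating `exists_next` makes `topSteps` strictly decrease, so the walk reaches the top and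
repeats no vertex. -/
theorem exists_shortest_path (x : α) : ∃ (n : ℕ) (q : ℕ → α), q 0 = x ∧ q n = ⊤ ∧
    Set.InjOn q (Set.Iic n) ∧
    ∀ i < n, (q i ⋖ q (i + 1) ∧ topDist (q i) = topDist (q (i + 1)) + 1) ∨
      (q (i + 1) ⋖ q i ∧ topDist (q i) = topDist (q (i + 1))) := by
  suffices ∃ (n : ℕ) (q : ℕ → α), q 0 = x ∧ q n = ⊤ ∧
      (∀ i < n, topSteps (q (i + 1)) < topSteps (q i)) ∧
      ∀ i < n, (q i ⋖ q (i + 1) ∧ topDist (q i) = topDist (q (i + 1)) + 1) ∨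
        (q (i + 1) ⋖ q i ∧ topDist (q i) = topDist (q (i + 1))) by
    obtain ⟨n, q, h0, hn, hs, hq⟩ := this
    refine ⟨n, q, h0, hn, ?_, hq⟩
    have hanti : ∀ a b, a < b → b ≤ n → topSteps (q b) < topSteps (q a) := by
      intro a b hab
      induction b, hab using Nat.le_induction with
      | base => exact fun hb ↦ hs a (by omega)
      | succ b hab ih => exact fun hb ↦ (hs b (by omega)).trans (ih (by omega))
    intro a ha b hb hab
    rcases lt_trichotomy a b with h | h | h
    · exact absurd (hanti a b h hb) (by rw [hab]; exact lt_irrefl _)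
    · exact h
    · exact absurd (hanti b a h ha) (by rw [hab]; exact lt_irrefl _)
  induction hl : topSteps x using Nat.strong_induction_on generalizing x with
  | _ l ih =>
    by_cases hx : x = ⊤
    · exact ⟨0, fun _ ↦ ⊤, hx.symm, rfl, by simp, by simp⟩
    · obtain ⟨y, hy, hxy⟩ := exists_next x hx
      obtain ⟨n, q, h0, hn, hs, hq⟩ := ih _ (hl ▸ hy) y rfl
      refine ⟨n + 1, fun i ↦ Nat.casesOn i x q, rfl, hn, ?_, ?_⟩
      · rintro (_ | i) hi
        · simpa [h0] using hy
        · exact hs i (by omega)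
      · rintro (_ | i) hi
        · simpa [h0] using hxy
        · exact hq i (by omega)

end TopDist

/-! ### The lower rank as a distance, and the effect of adjoining two elements -/

section LowerRank

theorem lowerRank_le {Q : Type*} [PartialOrder Q] (C : HassePath Q) (hmax : C.IsMaximalPath)
    (hstar : C.SatisfiesStar) : lowerRank Q ≤ C.upperLength :=
  sInf_le ⟨C, hmax, hstar, rfl⟩

theorem lowerRank_eq_topDist {α : Type*} [PartialOrder α] [BoundedOrder α] [Finite α] :
    lowerRank α = topDist (⊥ : α) := by
  apply le_antisymm
  · obtain ⟨n, q, h0, hn, hinj, hq⟩ := exists_shortest_path (⊥ : α)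
    let C : HassePath α :=
      { n := n
        q := q
        distinct := hinj
        isMin_first := h0 ▸ isMin_bot
        last_ascends := by
          rintro i rfl
          rcases hq i (by omega) with h | h
          · exact h.1
          · exact absurd h.1.lt (by simp [hn])
        step := fun i hi ↦ (hq i hi).imp And.left And.left }
    have hup : ∀ i < C.n, C.q i ⋖ C.q (i + 1) → topDist (C.q i) = topDist (C.q (i + 1)) + 1 :=
      fun i hi h ↦ (hq i hi).elim And.right fun h' ↦ absurd h.lt h'.1.lt.not_gt
    have hdown : ∀ i < C.n, C.q (i + 1) ⋖ C.q i → topDist (C.q i) = topDist (C.q (i + 1)) :=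
      fun i hi h ↦ (hq i hi).elim (fun h' ↦ absurd h.lt h'.1.lt.not_gt) And.right
    refine (lowerRank_le C (show IsMax (q n) from hn ▸ isMax_top)
      (HassePath.satisfiesStar_of_potential topDist_antitone hup hdown)).trans ?_
    have h := HassePath.eq_add_upperLength hup hdown
    rw [show C.q 0 = ⊥ from h0, show C.q C.n = ⊤ from hn, topDist_top, zero_add] at h
    rw [h]
  · refine le_sInf ?_
    rintro _ ⟨C, hmax, -, rfl⟩
    have h := C.le_add_upperLength (d := topDist) (fun _ _ ↦ topDist_le_of_covBy)
      fun _ _ h ↦ topDist_antitone h.le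
    rw [isMin_iff_eq_bot.1 C.isMin_first, isMax_iff_eq_top.1 hmax, topDist_top, zero_add] at h
    exact_mod_cast h

theorem exists_extended_coe {P : Type*} {x : ExtendedPoset P} (hb : x ≠ ⊥) (ht : x ≠ ⊤) :
    ∃ a : P, ((a : WithTop P) : ExtendedPoset P) = x := by
  induction x using WithBot.recBotCoe with
  | bot => exact absurd rfl hb
  | coe x =>
    induction x using WithTop.recTopCoe with
    | top => exact absurd rfl ht
    | coe a => exact ⟨a, rfl⟩

variable {P : Type*} [PartialOrder P]

theorem bot_covBy_extended_iff {a : P} :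
    (⊥ : ExtendedPoset P) ⋖ ((a : WithTop P) : ExtendedPoset P) ↔ IsMin a := by
  rw [WithBot.bot_covBy_coe]
  constructor
  · intro h b hb
    exact WithTop.coe_le_coe.1 (h (WithTop.coe_le_coe.2 hb))
  · intro h b hb
    induction b using WithTop.recTopCoe with
    | top => exact le_top
    | coe b => exact WithTop.coe_le_coe.2 (h (WithTop.coe_le_coe.1 hb))

theorem extended_covBy_top_iff {a : P} :
    ((a : WithTop P) : ExtendedPoset P) ⋖ ⊤ ↔ IsMax a := by
  rw [← WithBot.coe_top, WithBot.coe_covBy_coe, WithTop.coe_covBy_top]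

theorem extended_covBy_iff {a b : P} :
    ((a : WithTop P) : ExtendedPoset P) ⋖ ((b : WithTop P) : ExtendedPoset P) ↔ a ⋖ b := by
  rw [WithBot.coe_covBy_coe, WithTop.coe_covBy_coe]

/-- The distance of the extended poset, restricted to `P`, is a potential for paths in `P`; the
covers below a minimal and above a maximal element add at most one each. -/
theorem topDist_le_lowerRank_add_two [Finite P] :
    (topDist (⊥ : ExtendedPoset P) : ℕ∞) ≤ lowerRank P + 2 := by
  rw [← tsub_le_iff_right]
  refine le_sInf ?_
  rintro _ ⟨C, hmax, -, rfl⟩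
  rw [tsub_le_iff_right]
  have h := C.le_add_upperLength (d := fun a ↦ topDist ((a : WithTop P) : ExtendedPoset P))
    (fun _ _ h ↦ topDist_le_of_covBy (extended_covBy_iff.2 h))
    fun _ _ h ↦ topDist_antitone (extended_covBy_iff.2 h).le
  have h1 := topDist_le_of_covBy (bot_covBy_extended_iff.2 C.isMin_first)
  have h2 := topDist_le_of_covBy (extended_covBy_top_iff.2 hmax)
  rw [topDist_top] at h2
  exact_mod_cast (by omega : topDist (⊥ : ExtendedPoset P) ≤ C.upperLength + 2)

/-- A shortest path from bottom to top never returns to its ends, so its interior is a path in `P`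
with the restricted potential; the two deleted edges are ascents. -/
theorem lowerRank_add_two_le_topDist [Finite P] [Nonempty P] :
    lowerRank P + 2 ≤ (topDist (⊥ : ExtendedPoset P) : ℕ∞) := by
  obtain ⟨n, q, h0, hn, hinj, hq⟩ := exists_shortest_path (⊥ : ExtendedPoset P)
  obtain ⟨a⟩ := ‹Nonempty P›
  have hn0 : n ≠ 0 := by
    rintro rfl
    exact absurd (h0.symm.trans hn) bot_ne_top
  -- An element of `P` lies strictly between bottom and top, which therefore do not form a cover.
  have hn1 : n ≠ 1 := by
    rintro rfl
    have h := hq 0 (by omega)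
    rw [zero_add, h0, hn] at h
    rcases h with h | h
    · exact h.1.2 (c := ((a : WithTop P) : ExtendedPoset P)) (WithBot.bot_lt_coe _)
        (WithBot.coe_lt_coe.2 (WithTop.coe_lt_top a))
    · exact not_top_lt h.1.lt
  obtain ⟨m, rfl⟩ : ∃ m, n = m + 2 := ⟨n - 2, by omega⟩
  have hr : ∀ i, ∃ b : P, i ≤ m → ((b : WithTop P) : ExtendedPoset P) = q (i + 1) := by
    intro i
    by_cases hi : i ≤ m
    · obtain ⟨b, hb⟩ := exists_extended_coe (x := q (i + 1))
        (fun h ↦ by simpa using hinj (show i + 1 ≤ m + 2 by omega) (Nat.zero_le _) (h.trans h0.symm))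
        (fun h ↦ by
          have := hinj (show i + 1 ≤ m + 2 by omega) (show m + 2 ≤ m + 2 by omega)
            (h.trans hn.symm)
          omega)
      exact ⟨b, fun _ ↦ hb⟩
    · exact ⟨a, fun h ↦ absurd h hi⟩
  choose r hr using hr
  have hfirst := hq 0 (by omega)
  rw [h0, ← hr 0 (by omega)] at hfirst
  replace hfirst := hfirst.resolve_right fun h ↦ not_lt_bot h.1.lt
  have hlast := hq (m + 1) (by omega)
  rw [hn, ← hr m le_rfl, topDist_top] at hlast
  replace hlast := hlast.resolve_right fun h ↦ not_top_lt h.1.lt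
  have hmid : ∀ i < m,
      (r i ⋖ r (i + 1) ∧ topDist ((r i : WithTop P) : ExtendedPoset P) =
        topDist ((r (i + 1) : WithTop P) : ExtendedPoset P) + 1) ∨
      (r (i + 1) ⋖ r i ∧ topDist ((r i : WithTop P) : ExtendedPoset P) =
        topDist ((r (i + 1) : WithTop P) : ExtendedPoset P)) := by
    intro i hi
    have h := hq (i + 1) (by omega)
    rwa [← hr i (by omega), ← hr (i + 1) (by omega), extended_covBy_iff, extended_covBy_iff] at h
  have hmaxm : IsMax (r m) := extended_covBy_top_iff.1 hlast.1
  let C : HassePath P :=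
    { n := m
      q := r
      distinct := by
        intro i hi j hj hij
        have := hinj (show i + 1 ≤ m + 2 from Nat.le_succ_of_le (Nat.succ_le_succ hi))
          (show j + 1 ≤ m + 2 from Nat.le_succ_of_le (Nat.succ_le_succ hj))
          (by rw [← hr i hi, ← hr j hj, hij])
        omega
      isMin_first := bot_covBy_extended_iff.1 hfirst.1
      last_ascends := by
        rintro i rfl
        exact (hmid i (by omega)).elim And.left fun h ↦ absurd h.1.lt hmaxm.not_lt
      step := fun i hi ↦ (hmid i hi).imp And.left And.left }
  let d : P → ℕ := fun a ↦ topDist ((a : WithTop P) : ExtendedPoset P)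
  have hd : Antitone d := fun a b h ↦
    topDist_antitone (WithBot.coe_le_coe.2 (WithTop.coe_le_coe.2 h))
  have hup : ∀ i < C.n, C.q i ⋖ C.q (i + 1) → d (C.q i) = d (C.q (i + 1)) + 1 :=
    fun i hi h ↦ (hmid i hi).elim And.right fun h' ↦ absurd h.lt h'.1.lt.not_gt
  have hdown : ∀ i < C.n, C.q (i + 1) ⋖ C.q i → d (C.q i) = d (C.q (i + 1)) :=
    fun i hi h ↦ (hmid i hi).elim (fun h' ↦ absurd h.lt h'.1.lt.not_gt) And.right
  have hle := lowerRank_le C hmaxm (HassePath.satisfiesStar_of_potential hd hup hdown)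
  have hlen : topDist ((r 0 : WithTop P) : ExtendedPoset P) =
      topDist ((r m : WithTop P) : ExtendedPoset P) + C.upperLength :=
    HassePath.eq_add_upperLength (d := d) hup hdown
  refine (add_le_add_left hle 2).trans ?_
  have h1 := hfirst.2
  have h2 := hlast.2
  exact_mod_cast (by omega : C.upperLength + 2 ≤ topDist (⊥ : ExtendedPoset P))

theorem lowerRank_extendedPoset [Finite P] [Nonempty P] :
    lowerRank (ExtendedPoset P) = lowerRank P + 2 :=
  lowerRank_eq_topDist.trans
    (le_antisymm topDist_le_lowerRank_add_two lowerRank_add_two_le_topDist)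

end LowerRank

/-! ### Monomials of the Hibi ring -/

section HibiMonomials

open MvPolynomial

variable {P : Type*}

/-- The exponent vector of a monomial as a function on the extended poset: its value at the least
element is the exponent of `T`, and its value at the greatest element is zero. -/
def hibiVal (w : Option P →₀ ℕ) : ExtendedPoset P → ℕ :=
  WithBot.recBotCoe (w none) (WithTop.recTopCoe 0 fun a ↦ w (some a))

@[simp]
theorem hibiVal_bot (w : Option P →₀ ℕ) : hibiVal w ⊥ = w none := rfl

@[simp]
theorem hibiVal_coe (w : Option P →₀ ℕ) (a : P) :
    hibiVal w ((a : WithTop P) : ExtendedPoset P) = w (some a) := rfl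

@[simp]
theorem hibiVal_coe_top (w : Option P →₀ ℕ) :
    hibiVal w ((⊤ : WithTop P) : ExtendedPoset P) = 0 := rfl

@[simp]
theorem hibiVal_top (w : Option P →₀ ℕ) : hibiVal w ⊤ = 0 := rfl

theorem extendedPoset_induction {motive : ExtendedPoset P → Prop} (bot : motive ⊥)
    (coe : ∀ a : P, motive ((a : WithTop P) : ExtendedPoset P))
    (top : motive ((⊤ : WithTop P) : ExtendedPoset P)) (x : ExtendedPoset P) : motive x := by
  induction x using WithBot.recBotCoe with
  | bot => exact bot
  | coe x =>
    induction x using WithTop.recTopCoe with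
    | top => exact top
    | coe a => exact coe a

@[simp]
theorem hibiVal_add (v w : Option P →₀ ℕ) (x : ExtendedPoset P) :
    hibiVal (v + w) x = hibiVal v x + hibiVal w x := by
  induction x using extendedPoset_induction <;> simp

@[simp]
theorem hibiVal_smul (n : ℕ) (w : Option P →₀ ℕ) (x : ExtendedPoset P) :
    hibiVal (n • w) x = n * hibiVal w x := by
  induction x using extendedPoset_induction <;> simp

theorem le_of_hibiVal_le {v w : Option P →₀ ℕ} (h : ∀ x, hibiVal v x ≤ hibiVal w x) : v ≤ w := by
  rintro (_ | a)
  · exact h ⊥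
  · exact h ((a : WithTop P) : ExtendedPoset P)

/-- The exponent vector with prescribed values on the extended poset without its greatest
element. -/
noncomputable def hibiExponent [Finite P] (v : ExtendedPoset P → ℕ) : Option P →₀ ℕ :=
  Finsupp.equivFunOnFinite.symm fun o ↦ o.elim (v ⊥) fun a ↦ v ((a : WithTop P) : ExtendedPoset P)

theorem hibiVal_hibiExponent [Finite P] {v : ExtendedPoset P → ℕ} (hv : v ⊤ = 0) :
    hibiVal (hibiExponent v) = v := by
  funext x
  induction x using extendedPoset_induction with
  | bot => rfl
  | coe a => rfl
  | top => exact hv.symm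

variable [PartialOrder P]

theorem antitone_hibiVal_iff {w : Option P →₀ ℕ} : Antitone (hibiVal w) ↔
    (∀ a, w (some a) ≤ w none) ∧ ∀ a b, a ≤ b → w (some b) ≤ w (some a) := by
  constructor
  · exact fun h ↦ ⟨fun a ↦ h (bot_le (a := ((a : WithTop P) : ExtendedPoset P))),
      fun a b hab ↦ h (WithBot.coe_le_coe.2 (WithTop.coe_le_coe.2 hab))⟩
  · rintro ⟨h1, h2⟩ x y hxy
    induction y using extendedPoset_induction with
    | bot => rw [le_bot_iff.1 hxy]
    | top => exact Nat.zero_le _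
    | coe b =>
      induction x using extendedPoset_induction with
      | bot => exact h1 b
      | top => exact absurd (WithBot.coe_le_coe.1 hxy) (WithTop.coe_lt_top b).not_ge
      | coe a => exact h2 a b (WithTop.coe_le_coe.1 (WithBot.coe_le_coe.1 hxy))

variable [Fintype P]

open Classical in
/-- The exponent vector of the generator of the Hibi ring given by a poset ideal. -/
noncomputable def idealExponent (I : LowerSet P) : Option P →₀ ℕ :=
  Finsupp.equivFunOnFinite.symm fun o ↦ o.elim 1 fun a ↦ if a ∈ I then 1 else 0

@[simp]
theorem idealExponent_none (I : LowerSet P) : idealExponent I none = 1 := rfl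

open Classical in
@[simp]
theorem idealExponent_some (I : LowerSet P) (a : P) :
    idealExponent I (some a) = if a ∈ I then 1 else 0 := rfl

theorem antitone_hibiVal_idealExponent (I : LowerSet P) : Antitone (hibiVal (idealExponent I)) := by
  classical
  refine antitone_hibiVal_iff.2 ⟨fun a ↦ ?_, fun a b hab ↦ ?_⟩
  · rw [idealExponent_some, idealExponent_none]
    split_ifs <;> simp
  · rw [idealExponent_some, idealExponent_some]
    by_cases hb : b ∈ I
    · rw [if_pos hb, if_pos (show a ∈ I from I.lower hab hb)]
    · rw [if_neg hb]
      exact Nat.zero_le _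

variable (k : Type*) [Field k]

theorem hibiMonomial_eq_monomial (I : LowerSet P) :
    hibiMonomial k P I = monomial (idealExponent I) 1 := by
  classical
  rw [hibiMonomial, monomial_eq, C_1, one_mul, Finsupp.prod_fintype _ _ (by simp),
    Fintype.prod_option, idealExponent_none, pow_one, Finset.prod_filter]
  congr 1
  refine Finset.prod_congr (by congr) fun a _ ↦ ?_
  rw [idealExponent_some]
  split_ifs <;> simp

theorem coe_hibiGen (I : LowerSet P) :
    (hibiGen k P I : MvPolynomial (Option P) k) = monomial (idealExponent I) 1 :=
  hibiMonomial_eq_monomial k I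

variable {k}

theorem antitone_of_mem_support {f : MvPolynomial (Option P) k} (hf : f ∈ hibiRing k P) :
    ∀ w ∈ f.support, Antitone (hibiVal w) := by
  classical
  induction hf using Algebra.adjoin_induction with
  | mem f hf =>
    obtain ⟨I, rfl⟩ := hf
    intro w hw
    rw [hibiMonomial_eq_monomial] at hw
    rw [Finset.mem_singleton.1 (support_monomial_subset hw)]
    exact antitone_hibiVal_idealExponent I
  | algebraMap c =>
    intro w hw
    rw [Finset.mem_singleton.1 (support_monomial_subset hw)]
    exact antitone_hibiVal_iff.2 ⟨fun a ↦ le_rfl, fun a b _ ↦ le_rfl⟩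
  | add f g _ _ hf hg =>
    intro w hw
    exact (Finset.mem_union.1 (support_add hw)).elim (hf w) (hg w)
  | mul f g _ _ hf hg =>
    intro w hw
    obtain ⟨u, hu, v, hv, rfl⟩ := Finset.mem_add.1 (support_mul f g hw)
    intro x y hxy
    rw [hibiVal_add, hibiVal_add]
    exact add_le_add (hf u hu hxy) (hg v hv hxy)

/-- Peel off layers: the elements with positive exponent form a poset ideal, and dividing by its
generator lowers every positive exponent by one and keeps the function antitone. -/
theorem exists_mem_pow_eq_monomial {w : Option P →₀ ℕ} (hw : Antitone (hibiVal w)) :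
    ∃ r ∈ hibiMaxIdeal k P ^ w none, (r : MvPolynomial (Option P) k) = monomial w 1 := by
  classical
  induction hN : w none generalizing w with
  | zero =>
    refine ⟨1, by simp, ?_⟩
    have h0 : w = 0 := by
      ext o
      rcases o with _ | a
      · exact hN
      · exact Nat.le_zero.1 (hN ▸ (antitone_hibiVal_iff.1 hw).1 a)
    rw [h0]
    rfl
  | succ N ih =>
    obtain ⟨h1, h2⟩ := antitone_hibiVal_iff.1 hw
    let I : LowerSet P := ⟨{a | 0 < w (some a)}, fun a b hba ha ↦ ha.trans_le (h2 b a hba)⟩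
    have hI : ∀ a, a ∈ I ↔ 0 < w (some a) := fun _ ↦ Iff.rfl
    have hsub : ∀ a, (w - idealExponent I) (some a) = w (some a) - 1 := by
      intro a
      rw [Finsupp.tsub_apply, idealExponent_some]
      by_cases ha : a ∈ I
      · rw [if_pos ha]
      · have := (hI a).not.1 ha
        rw [if_neg ha]
        omega
    have hnone : (w - idealExponent I) none = N := by
      rw [Finsupp.tsub_apply, idealExponent_none, hN, Nat.add_sub_cancel]
    have hadd : idealExponent I + (w - idealExponent I) = w := by
      refine add_tsub_cancel_of_le ?_
      rintro (_ | a)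
      · rw [idealExponent_none]
        omega
      · rw [idealExponent_some]
        split_ifs with ha
        · exact (hI a).1 ha
        · exact Nat.zero_le _
    obtain ⟨r, hr, hrw⟩ := ih (w := w - idealExponent I) (antitone_hibiVal_iff.2
      ⟨fun a ↦ by rw [hsub, hnone]; have := h1 a; omega,
        fun a b hab ↦ by rw [hsub, hsub]; exact Nat.sub_le_sub_right (h2 a b hab) 1⟩) hnone
    refine ⟨hibiGen k P I * r, ?_, ?_⟩
    · rw [pow_succ']
      exact Ideal.mul_mem_mul (Ideal.subset_span ⟨I, rfl⟩) hr
    · rw [MulMemClass.coe_mul, hrw, coe_hibiGen, monomial_mul, hadd, one_mul]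

theorem monomial_mem_hibiRing {w : Option P →₀ ℕ} (hw : Antitone (hibiVal w)) (c : k) :
    monomial w c ∈ hibiRing k P := by
  obtain ⟨r, -, hr⟩ := exists_mem_pow_eq_monomial (k := k) hw
  rw [← mul_one c, ← C_mul_monomial, ← hr]
  exact mul_mem ((hibiRing k P).algebraMap_mem c) r.2

theorem mem_hibiRing_iff {f : MvPolynomial (Option P) k} :
    f ∈ hibiRing k P ↔ ∀ w ∈ f.support, Antitone (hibiVal w) := by
  refine ⟨antitone_of_mem_support, fun h ↦ ?_⟩
  rw [← f.support_sum_monomial_coeff]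
  exact sum_mem fun w hw ↦ monomial_mem_hibiRing (h w hw) _

/-- Every generator is divisible by T, so the N-th power of the ideal extends into (T^N) in the
polynomial ring. -/
theorem le_of_mem_hibiMaxIdeal_pow {N : ℕ} {f : hibiRing k P} (hf : f ∈ hibiMaxIdeal k P ^ N)
    {w : Option P →₀ ℕ} (hw : w ∈ (f : MvPolynomial (Option P) k).support) : N ≤ w none := by
  have h1 : (hibiMaxIdeal k P).map (hibiRing k P).val ≤ Ideal.span {X none} := by
    rw [hibiMaxIdeal, Ideal.map_span, Ideal.span_le]
    rintro _ ⟨_, ⟨I, rfl⟩, rfl⟩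
    exact Ideal.mem_span_singleton.2 (Dvd.intro _ rfl)
  have h2 : (f : MvPolynomial (Option P) k) ∈ Ideal.span {(X none) ^ N} := by
    rw [← Ideal.span_singleton_pow]
    refine Ideal.pow_right_mono h1 N ?_
    rw [← Ideal.map_pow]
    exact Ideal.mem_map_of_mem _ hf
  obtain ⟨g, hg⟩ := Ideal.mem_span_singleton.1 h2
  rw [mem_support_iff, hg, X_pow_eq_monomial, coeff_monomial_mul'] at hw
  by_contra hlt
  refine hw (if_neg fun hle ↦ hlt ?_)
  simpa using hle none

end HibiMonomials

/-! ### Splittings -/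

section Splitting

open MvPolynomial

/-- Over a field the injection k → k^{1/q} has a linear left inverse, so `k` need not be perfect. -/
theorem exists_frobenius_section (p : ℕ) [Fact p.Prime] (k : Type*) [Field k] [CharP k p] (e : ℕ) :
    ∃ φ : k →+ k, φ 1 = 1 ∧ ∀ a b, φ (a ^ p ^ e * b) = a * φ b := by
  obtain ⟨f, hf⟩ := (LinearMap.toSpanSingleton k (FrobeniusRoot k p e)
    (frobeniusRoot p e (1 : k))).exists_leftInverse_of_injective (by
      rw [LinearMap.ker_eq_bot']
      intro a ha
      rw [LinearMap.toSpanSingleton_apply, smul_frobeniusRoot, mul_one] at ha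
      exact eq_zero_of_pow_eq_zero ha)
  refine ⟨⟨⟨fun a ↦ f (frobeniusRoot p e a), f.map_zero⟩, fun a b ↦ f.map_add _ _⟩, ?_, ?_⟩
  · have := LinearMap.congr_fun hf 1
    rwa [LinearMap.comp_apply, LinearMap.toSpanSingleton_apply, one_smul] at this
  · intro a b
    exact f.map_smul a (frobeniusRoot p e b)

/-- The additive map on polynomials that extracts the coefficients at `q • v + w` and applies `φ`
to them. -/
noncomputable def rootTrace {σ k : Type*} [Field k] (φ : k →+ k) {q : ℕ} (hq : q ≠ 0)
    (w : σ →₀ ℕ) : MvPolynomial σ k →+ MvPolynomial σ k where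
  toFun g := ⟨((AddMonoidAlgebra.coeff g).comapDomain (fun v ↦ q • v + w)
    (fun u _ v _ huv ↦ smul_right_injective _ hq (add_right_cancel huv))).mapRange φ φ.map_zero⟩
  map_zero' := by
    ext v
    exact φ.map_zero
  map_add' f g := by
    ext v
    exact φ.map_add _ _

theorem coeff_rootTrace {σ k : Type*} [Field k] (φ : k →+ k) {q : ℕ} (hq : q ≠ 0)
    (w v : σ →₀ ℕ) (g : MvPolynomial σ k) :
    coeff v (rootTrace φ hq w g) = φ (coeff (q • v + w) g) := rfl

variable {k : Type*} [Field k] {P : Type*} [PartialOrder P] [Fintype P]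

theorem antitone_of_forall_covBy {α β : Type*} [PartialOrder α] [Finite α] [Preorder β]
    {f : α → β} (h : ∀ x y, x ⋖ y → f y ≤ f x) : Antitone f := by
  classical
  cases nonempty_fintype α
  let _ : LocallyFiniteOrder α := Fintype.toLocallyFiniteOrder
  exact (antitone_iff_forall_covBy f).2 h

/-- If the values of `w` drop by less than `q` on covers, then `v` is an exponent vector of the
Hibi ring if `q • v + w` is one up to a multiple of `q`. -/
theorem le_and_antitone_of_add_smul_eq {q : ℕ} {a u v w : Option P →₀ ℕ}
    (hw : ∀ x y, x ⋖ y → hibiVal w x < hibiVal w y + q) (hu : Antitone (hibiVal u))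
    (h : u + q • a = q • v + w) :
    a ≤ v ∧ Antitone (fun x ↦ (hibiVal v x : ℤ) - hibiVal a x) := by
  have hval : ∀ x, (hibiVal u x : ℤ) + q * hibiVal a x = q * hibiVal v x + hibiVal w x := by
    intro x
    have := congrArg (hibiVal · x) h
    simp only [hibiVal_add, hibiVal_smul] at this
    exact_mod_cast this
  have hanti : Antitone (fun x ↦ (hibiVal v x : ℤ) - hibiVal a x) := by
    refine antitone_of_forall_covBy fun x y hxy ↦ ?_
    have h1 := hval x
    have h2 := hval y
    have h3 : (hibiVal u y : ℤ) ≤ hibiVal u x := by exact_mod_cast hu hxy.le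
    have h4 : (hibiVal w x : ℤ) < hibiVal w y + q := by exact_mod_cast hw x y hxy
    -- If the integer-valued v - a rises on the cover, it rises by at least 1; since w drops by less
    -- than q, also u = q(v - a) + w would rise.
    by_contra hlt
    push Not at hlt
    nlinarith
  refine ⟨le_of_hibiVal_le fun x ↦ ?_, hanti⟩
  have := hanti (le_top (a := x))
  simp only [hibiVal_top] at this
  omega

theorem rootTrace_mem_hibiRing (φ : k →+ k) {q : ℕ} (hq : q ≠ 0) {w : Option P →₀ ℕ}
    (hw : ∀ x y, x ⋖ y → hibiVal w x < hibiVal w y + q) {g : MvPolynomial (Option P) k}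
    (hg : g ∈ hibiRing k P) : rootTrace φ hq w g ∈ hibiRing k P := by
  refine mem_hibiRing_iff.2 fun v hv ↦ ?_
  rw [mem_support_iff, coeff_rootTrace] at hv
  have hu := antitone_of_mem_support hg (q • v + w)
    (mem_support_iff.2 fun h ↦ hv (by rw [h, map_zero]))
  have h := (le_and_antitone_of_add_smul_eq hw hu
    (show q • v + w + q • (0 : Option P →₀ ℕ) = q • v + w by simp)).2
  intro x y hxy
  have h0 : ∀ x : ExtendedPoset P, hibiVal (0 : Option P →₀ ℕ) x = 0 := fun x ↦ by
    simpa using hibiVal_smul 0 (0 : Option P →₀ ℕ) x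
  simpa [h0] using h hxy

theorem rootTrace_monomial_mul (φ : k →+ k) {q : ℕ} (hq : q ≠ 0) {w : Option P →₀ ℕ}
    (hw : ∀ x y, x ⋖ y → hibiVal w x < hibiVal w y + q) {g : MvPolynomial (Option P) k}
    (hg : g ∈ hibiRing k P) (a : Option P →₀ ℕ) :
    rootTrace φ hq w (monomial (q • a) 1 * g) = monomial a 1 * rootTrace φ hq w g := by
  ext v
  rw [coeff_rootTrace, coeff_monomial_mul', coeff_monomial_mul', one_mul, one_mul]
  by_cases hav : a ≤ v
  · have hle : q • a ≤ q • v + w := (nsmul_le_nsmul_right hav q).trans le_self_add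
    rw [if_pos hav, if_pos hle, coeff_rootTrace]
    congr 2
    rw [tsub_eq_iff_eq_add_of_le hle, add_right_comm, ← smul_add, tsub_add_cancel_of_le hav]
  · rw [if_neg hav]
    split_ifs with hle
    -- A nonzero coefficient here gives an exponent u of `g` with u + qa = qv + w, which forces a ≤
    -- v.
    · by_contra hne
      refine hav (le_and_antitone_of_add_smul_eq hw (antitone_of_mem_support hg
        (q • v + w - q • a) (mem_support_iff.2 fun h ↦ hne (by rw [h, map_zero]))) ?_).1
      exact tsub_add_cancel_of_le hle
    · exact map_zero φ

theorem rootTrace_pow_mul {p : ℕ} [Fact p.Prime] [CharP k p] {e : ℕ} {φ : k →+ k}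
    (hφ : ∀ a b, φ (a ^ p ^ e * b) = a * φ b) (hq : p ^ e ≠ 0) {w : Option P →₀ ℕ}
    (hw : ∀ x y, x ⋖ y → hibiVal w x < hibiVal w y + p ^ e) {r g : MvPolynomial (Option P) k}
    (hr : r ∈ hibiRing k P) (hg : g ∈ hibiRing k P) :
    rootTrace φ hq w (r ^ p ^ e * g) = r * rootTrace φ hq w g := by
  induction hr using Algebra.adjoin_induction generalizing g with
  | mem r hr =>
    obtain ⟨I, rfl⟩ := hr
    rw [hibiMonomial_eq_monomial, monomial_pow, one_pow, rootTrace_monomial_mul φ hq hw hg]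
  | algebraMap c =>
    ext v
    rw [← map_pow, algebraMap_eq, coeff_rootTrace, coeff_C_mul, coeff_C_mul,
      coeff_rootTrace, hφ]
  | add r s _ _ hr hs =>
    rw [add_pow_char_pow, add_mul, map_add, hr hg, hs hg, add_mul]
  | mul r s hr' hs' hr hs =>
    rw [mul_pow, mul_assoc, hr (mul_mem (pow_mem hs' _) hg), hs hg, mul_assoc]

theorem rootMapSplits_of_covBy {p : ℕ} [Fact p.Prime] [CharP k p] {e : ℕ} {w : Option P →₀ ℕ}
    (hw : ∀ x y, x ⋖ y → hibiVal w x < hibiVal w y + p ^ e) {d : hibiRing k P}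
    (hd : (d : MvPolynomial (Option P) k) = monomial w 1) : RootMapSplits p e d := by
  classical
  obtain ⟨φ, hφ1, hφ⟩ := exists_frobenius_section p k e
  have hq : p ^ e ≠ 0 := pow_ne_zero _ (Fact.out : p.Prime).ne_zero
  let f : FrobeniusRoot (hibiRing k P) p e →ₗ[hibiRing k P] hibiRing k P :=
    { toFun := fun g : hibiRing k P ↦ ⟨rootTrace φ hq w g, rootTrace_mem_hibiRing φ hq hw g.2⟩
      map_add' := fun g h : hibiRing k P ↦ Subtype.ext (map_add (rootTrace φ hq w) g.1 h.1)
      map_smul' := fun (r g : hibiRing k P) ↦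
        Subtype.ext (rootTrace_pow_mul hφ hq hw r.2 g.2) }
  refine ⟨f, LinearMap.ext_ring ?_⟩
  rw [LinearMap.comp_apply, LinearMap.toSpanSingleton_apply, one_smul]
  refine Subtype.ext ?_
  change rootTrace φ hq w (d : MvPolynomial (Option P) k) = 1
  rw [hd]
  ext v
  rw [coeff_rootTrace, coeff_monomial, coeff_one]
  by_cases hv : 0 = v
  · rw [← hv, smul_zero, zero_add, if_pos rfl, if_pos rfl, hφ1]
  · rw [if_neg hv, if_neg, map_zero]
    intro h
    rw [eq_comm, add_eq_right, smul_eq_zero] at h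
    exact hv (h.resolve_left hq).symm

/-- A linear map `R^{1/q} → R` sends a monomial whose values drop by at least `q` on some cover to
an element without constant term. -/
theorem coeff_zero_eq_zero_of_covBy {p : ℕ} [Fact p.Prime] [CharP k p] {e : ℕ}
    (f : FrobeniusRoot (hibiRing k P) p e →ₗ[hibiRing k P] hibiRing k P)
    {w : Option P →₀ ℕ} (hw : Antitone (hibiVal w)) {x y : ExtendedPoset P} (hxy : x ⋖ y)
    (hlt : hibiVal w y + p ^ e ≤ hibiVal w x) (c : k) :
    coeff 0 (f (frobeniusRoot p e ⟨monomial w c, monomial_mem_hibiRing hw c⟩) :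
      MvPolynomial (Option P) k) = 0 := by
  classical
  have hyx : ¬ y ≤ x := hxy.lt.not_ge
  -- Two monomials n and s of R such that s - n rises on the pair x < y by exactly one and on no
  -- other pair. Then u = q(s - n) + w is still antitone, because w drops by at least q there. The
  -- condition y ≠ ⊤ makes s vanish at the top.
  let nv : ExtendedPoset P → ℕ := fun z ↦ if z ≤ x then 1 else 0
  let sv : ExtendedPoset P → ℕ := fun z ↦ (if z < x then 1 else 0) +
    if z ≤ y ∧ y ≠ ⊤ then 1 else 0
  have hn : hibiVal (hibiExponent nv) = nv :=
    hibiVal_hibiExponent (if_neg fun h ↦ hyx (le_top.trans h))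
  have hs : hibiVal (hibiExponent sv) = sv := by
    refine hibiVal_hibiExponent ?_
    have h2 : ¬ ((⊤ : ExtendedPoset P) ≤ y ∧ y ≠ ⊤) := fun h ↦ h.2 (top_le_iff.1 h.1)
    simp only [sv, if_neg not_top_lt, if_neg h2]
  have hna : Antitone nv := by
    intro a b hab
    simp only [nv]
    split_ifs with h1 h2 <;> first | omega | exact absurd (hab.trans h1) h2
  have hsa : Antitone sv := by
    intro a b hab
    refine add_le_add ?_ ?_
    · split_ifs with h1 h2 <;> first | omega | exact absurd (hab.trans_lt h1) h2
    · split_ifs with h1 h2 <;> first | omega | exact absurd ⟨hab.trans h1.1, h1.2⟩ h2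
  have hkey : ∀ a b, a < b → (a = x ∧ b = y) ∨ nv a + sv b ≤ nv b + sv a := by
    intro a b hab
    by_cases hbx : b ≤ x
    · right
      have := hsa hab.le
      simp only [nv, if_pos hbx, if_pos (hab.le.trans hbx)]
      omega
    by_cases hax : a ≤ x
    · rcases hax.lt_or_eq with hax' | rfl
      · right
        have h1 : ¬ b < x := fun h ↦ hbx h.le
        have h2 : (if b ≤ y ∧ y ≠ ⊤ then 1 else 0) ≤ if a ≤ y ∧ y ≠ ⊤ then 1 else 0 := by
          split_ifs with h3 h4 <;> first | omega | exact absurd ⟨hab.le.trans h3.1, h3.2⟩ h4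
        simp only [nv, sv, if_pos hax, if_neg hbx, if_pos hax', if_neg h1]
        omega
      · by_cases hby : b ≤ y
        · exact .inl ⟨rfl, hby.eq_of_not_lt (hxy.2 hab)⟩
        · right
          have h1 : ¬ b < a := hab.not_gt
          have h2 : a ≤ y ∧ y ≠ ⊤ := ⟨hxy.le, fun h ↦ hby (h ▸ le_top)⟩
          have h3 : ¬ (b ≤ y ∧ y ≠ ⊤) := fun h ↦ hby h.1
          simp only [nv, sv, if_pos hax, if_neg hbx, if_neg h1, if_pos h2, if_neg h3]
          omega
    · right
      have := hsa hab.le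
      simp only [nv, if_neg hbx, if_neg hax]
      omega
  have hnx : nv x = 1 := if_pos le_rfl
  have hny : nv y = 0 := if_neg hyx
  have hsxy : sv x = sv y := by
    simp only [sv, if_neg (lt_irrefl x), if_neg hxy.lt.not_gt, hxy.le, le_rfl]
  have hdrop : ∀ a b, a < b → p ^ e * nv a + (p ^ e * sv b + hibiVal w b) ≤
      p ^ e * nv b + (p ^ e * sv a + hibiVal w a) := by
    intro a b hab
    rcases hkey a b hab with ⟨rfl, rfl⟩ | h
    · rw [hnx, hny, hsxy]
      omega
    · have h1 := hw hab.le
      have h2 := Nat.mul_le_mul_left (p ^ e) h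
      rw [mul_add _ (nv a), mul_add _ (nv b)] at h2
      omega
  set s := hibiExponent sv
  set n := hibiExponent nv
  have hle : p ^ e • n ≤ p ^ e • s + w := by
    refine le_of_hibiVal_le fun z ↦ ?_
    rw [hibiVal_add, hibiVal_smul, hibiVal_smul, hn, hs]
    rcases (le_top (a := z)).lt_or_eq with hz | rfl
    · have h1 := hdrop z ⊤ hz
      have h2 : nv ⊤ = 0 := hn ▸ hibiVal_top n
      rw [h2] at h1
      omega
    · have h2 : nv ⊤ = 0 := hn ▸ hibiVal_top n
      rw [h2, mul_zero]
      exact Nat.zero_le _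
  obtain ⟨u, hu⟩ := exists_add_of_le hle
  have hua : Antitone (hibiVal u) := by
    intro a b hab
    rcases hab.lt_or_eq with hab | rfl
    · have h1 := hdrop a b hab
      have h2 : ∀ z, p ^ e * sv z + hibiVal w z = p ^ e * nv z + hibiVal u z := by
        intro z
        have := congrArg (hibiVal · z) hu
        simpa only [hibiVal_add, hibiVal_smul, hn, hs] using this
      rw [h2, h2] at h1
      omega
    · exact le_rfl
  let S : hibiRing k P := ⟨monomial s 1, monomial_mem_hibiRing (hs ▸ hsa) 1⟩
  let N : hibiRing k P := ⟨monomial n 1, monomial_mem_hibiRing (hn ▸ hna) 1⟩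
  have hmul : S ^ p ^ e * ⟨monomial w c, monomial_mem_hibiRing hw c⟩ =
      N ^ p ^ e * ⟨monomial u c, monomial_mem_hibiRing hua c⟩ := by
    refine Subtype.ext ?_
    change monomial s 1 ^ p ^ e * monomial w c = monomial n 1 ^ p ^ e * monomial u c
    rw [monomial_pow, monomial_pow, monomial_mul, monomial_mul, one_pow, hu]
  have hf : S * f (frobeniusRoot p e ⟨monomial w c, monomial_mem_hibiRing hw c⟩) =
      N * f (frobeniusRoot p e ⟨monomial u c, monomial_mem_hibiRing hua c⟩) := by
    rw [← smul_eq_mul, ← smul_eq_mul, ← f.map_smul, ← f.map_smul, smul_frobeniusRoot,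
      smul_frobeniusRoot, hmul]
  -- The coefficient at s is the constant term of f(w^{1/q}) on the left and the coefficient of
  -- f(u^{1/q}) at s - n on the right. The latter vanishes, since s - n is not an exponent of R.
  have hcoeff := congrArg (fun r : hibiRing k P ↦ coeff s (r : MvPolynomial (Option P) k)) hf
  simp only [MulMemClass.coe_mul, S, N] at hcoeff
  rw [coeff_monomial_mul', coeff_monomial_mul', if_pos le_rfl, tsub_self, one_mul, one_mul]
    at hcoeff
  rw [hcoeff]
  split_ifs with hns
  · by_contra hne
    have h1 := antitone_of_mem_support (Subtype.property _) _ (mem_support_iff.2 hne) hxy.le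
    have h2 : ∀ z, hibiVal (s - n) z + nv z = sv z := fun z ↦ by
      rw [← hn, ← hs, ← hibiVal_add, tsub_add_cancel_of_le hns]
    have h3 := h2 x
    have h4 := h2 y
    omega
  · rfl

/-- The constant term of `f` is additive and equals 1 at `d`, so it cannot vanish on all the terms
of `d`, which lie in R themselves. -/
theorem exists_mem_support_of_rootMapSplits {p : ℕ} [Fact p.Prime] [CharP k p] {e : ℕ}
    {d : hibiRing k P} (hd : RootMapSplits p e d) :
    ∃ w ∈ (d : MvPolynomial (Option P) k).support,
      ∀ x y, x ⋖ y → hibiVal w x < hibiVal w y + p ^ e := by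
  obtain ⟨f, hf⟩ := hd
  by_contra! hne
  have hf1 : f (frobeniusRoot p e d) = 1 := by
    have := LinearMap.congr_fun hf 1
    rwa [LinearMap.comp_apply, LinearMap.toSpanSingleton_apply, one_smul] at this
  have hanti := antitone_of_mem_support d.2
  let g : hibiRing k P →+ k :=
    { toFun := fun r ↦ coeff 0 (f (frobeniusRoot p e r) : MvPolynomial (Option P) k)
      map_zero' := by
        rw [show frobeniusRoot p e (0 : hibiRing k P) = 0 from rfl, map_zero]
        exact coeff_zero 0
      map_add' := fun r s ↦ by
        rw [show frobeniusRoot p e (r + s) = frobeniusRoot p e r + frobeniusRoot p e s from rfl,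
          map_add]
        exact coeff_add 0 _ _ }
  have hsum : d = ∑ w ∈ (d : MvPolynomial (Option P) k).support.attach,
      ⟨monomial w.1 (coeff w.1 (d : MvPolynomial (Option P) k)),
        monomial_mem_hibiRing (hanti w.1 w.2) _⟩ := by
    refine Subtype.ext ?_
    rw [AddSubmonoidClass.coe_finsetSum, Finset.sum_attach _ (fun w ↦
      monomial w (coeff w (d : MvPolynomial (Option P) k))), support_sum_monomial_coeff]
  have hg1 : g d = 1 := by
    change coeff 0 (f (frobeniusRoot p e d) : MvPolynomial (Option P) k) = 1
    rw [hf1]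
    exact coeff_zero_one
  have hg0 : g d = 0 := by
    rw [hsum, map_sum]
    refine Finset.sum_eq_zero fun w _ ↦ ?_
    obtain ⟨x, y, hxy, hlt⟩ := hne w.1 w.2
    exact coeff_zero_eq_zero_of_covBy f (hanti w.1 w.2) hxy hlt _
  exact one_ne_zero (hg1.symm.trans hg0)

end Splitting

/-! ### The F-pure threshold of the Hibi ring -/

section Threshold

open MvPolynomial

variable (p : ℕ) [Fact p.Prime] (k : Type*) [Field k] [CharP k p]
  (P : Type*) [PartialOrder P] [Fintype P]

/-- The witness is the monomial (q - 1)δ, which drops by at most q - 1 on covers; its degree is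
exactly the required exponent, for every e. -/
theorem isFPurePair_topDist :
    IsFPurePair p (hibiMaxIdeal k P) (topDist (⊥ : ExtendedPoset P) : ℝ≥0) := by
  refine Filter.Eventually.of_forall fun e ↦ ?_
  have hq : 1 ≤ p ^ e := Nat.one_le_pow _ _ (Fact.out : p.Prime).pos
  have hval : ∀ x, hibiVal ((p ^ e - 1) • hibiExponent (P := P) topDist) x =
      (p ^ e - 1) * topDist x := fun x ↦ by
    rw [hibiVal_smul, hibiVal_hibiExponent topDist_top]
  obtain ⟨d, hd, hdw⟩ := exists_mem_pow_eq_monomial (k := k)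
    (w := (p ^ e - 1) • hibiExponent (P := P) topDist) fun x y hxy ↦ by
      rw [hval, hval]
      exact Nat.mul_le_mul_left _ (topDist_antitone hxy)
  refine ⟨d, ?_, rootMapSplits_of_covBy (fun x y hxy ↦ ?_) hdw⟩
  · convert hd
    rw [← hibiVal_bot, hval, ← Nat.ceil_natCast (R := ℝ) ((p ^ e - 1) * _)]
    push_cast [Nat.cast_sub hq]
    rw [mul_comm]
  · rw [hval, hval]
    have := Nat.mul_le_mul_left (p ^ e - 1) (topDist_le_of_covBy hxy)
    rw [mul_add, mul_one] at this
    omega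

theorem le_topDist_of_isFPurePair {t : ℝ≥0} (ht : IsFPurePair p (hibiMaxIdeal k P) t) :
    t ≤ topDist (⊥ : ExtendedPoset P) := by
  -- A single e suffices; e ≥ 1 makes q - 1 positive, so that it can be cancelled at the end.
  obtain ⟨e, ⟨d, hd, hsplit⟩, he⟩ := (ht.and (Filter.eventually_ge_atTop 1)).exists
  obtain ⟨w, hw, hcov⟩ := exists_mem_support_of_rootMapSplits hsplit
  have hq : 1 < p ^ e := Nat.one_lt_pow (by omega) (Fact.out : p.Prime).one_lt
  have h1 := le_of_mem_hibiMaxIdeal_pow hd hw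
  have h2 := le_topDist_mul (hibiVal_top w) (antitone_of_mem_support d.2 w hw) (b := p ^ e - 1)
    (fun x y hxy ↦ by have := hcov x y hxy; omega) ⊥
  have h3 : (t : ℝ) * ((p : ℝ) ^ e - 1) ≤ topDist (⊥ : ExtendedPoset P) * ((p : ℝ) ^ e - 1) := by
    refine (Nat.le_ceil _).trans ?_
    have h4 := h1.trans h2
    rw [← Nat.cast_le (α := ℝ)] at h4
    push_cast [Nat.cast_sub hq.le] at h4
    exact h4
  have hq' : (0 : ℝ) < (p : ℝ) ^ e - 1 := sub_pos.2 (by exact_mod_cast hq)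
  exact_mod_cast le_of_mul_le_mul_right h3 hq'

theorem fpt_hibiMaxIdeal :
    fpt p (hibiMaxIdeal k P) = (topDist (⊥ : ExtendedPoset P) : ℝ≥0∞) := by
  refine le_antisymm (sSup_le ?_) (le_sSup ⟨_, isFPurePair_topDist p k P, by simp⟩)
  rintro _ ⟨t, ht, rfl⟩
  exact_mod_cast le_topDist_of_isFPurePair p k P ht

end Threshold

theorem theorem3p9 (p : ℕ) [Fact p.Prime] (k : Type*) [Field k] [CharP k p]
    (P : Type*) [PartialOrder P] [Fintype P] :
    fpt p (hibiMaxIdeal k P) = ((lowerRank (ExtendedPoset P) : ℕ∞) : ℝ≥0∞) ∧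
    (Nonempty P → lowerRank (ExtendedPoset P) = lowerRank P + 2) ∧
    ∃ n : ℕ, fpt p (hibiMaxIdeal k P) = (n : ℝ≥0∞) := by
  refine ⟨?_, fun _ ↦ lowerRank_extendedPoset, _, fpt_hibiMaxIdeal p k P⟩
  rw [fpt_hibiMaxIdeal, lowerRank_eq_topDist, ENat.toENNReal_coe]
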